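/- Let $d\ge 1$ and let $\Omega\subset\mathbb{R}^d$ be a bounded open set (for instance a bounded Lipschitz domain with an interior cone condition). There is a constant $C_P\ge 0$, depending only on $\Omega$, such that the following holds. **Problem.** Let $u\in W_\infty^m(\Omega)$ with $m\ge 2$ be continuous on $\overline\Omega$ and solve the Dirichlet problem $-\Delta u=f$ in $\Omega$ (almost everywhere, with weak second derivatives), $u=g$ on $\partial\Omega$, where $f$ and $g$ are given pointwise. For $v$ of class $C^2$ near $\overline\Omega$ put $\mathcal{L}v=-\Delta v$ in $\Omega$ and $\mathcal{L}v=v$ on $\partial\Omega$. Put $F=f$ in $\Omega$ and $F=g$ on $\partial\Omega$, so that $F=\mathcal{L}u$. Let $u$ be extended in any way to all of $\mathbb{R}^d$. **Discretization.** Let $\Omega_1,\dots,\Omega_P$ be open patches covering $\overline\Omega$, with weight functions $w_j$ that are $C^2$ on $\bigcup_i\Omega_i$, vanish outside $\Omega_j$ and satisfy $\sum_j w_j=1$ on $\overline\Omega$. Let $\phi$ be a radial basis function with $x\mapsto\phi(\|x\|)$ of class $C^2$ on $\mathbb{R}^d$. Let $X=(x_k)_{k=1}^N$ be nodes in $\mathbb{R}^d$,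 let $J_j\subseteq\{1,\dots,N\}$ index the local nodes $X_j=(x_k)_{k\in J_j}$ of patch $j$, and suppose that the matrices $\phi(X_j,X_j)=(\phi(\|x_i-x_k\|))_{i,k\in J_j}$ are nonsingular. Let $\psi(x,X_j)=\phi(x,X_j)\phi(X_j,X_j)^{-1}$ be the row of local cardinal functions $\psi^j_k$, $k\in J_j$. A vector $V\in\mathbb{R}^N$ of nodal values defines the approximation $\sum_j w_j\sum_{k\in J_j}\psi_k^jV_k$. The interpolant $\mathcal{I}(u)$ is the approximation with $V_k=u(x_k)$, and $\mathcal{E}_{\mathcal L}=\mathcal{L}(\mathcal{I}(u)-u)=\mathcal{L}\mathcal{I}(u)-F$. Put $L(x,X)_k=\sum_{j:\,k\in J_j}\mathcal{L}(w_j\psi^j_k)(x)$. For evaluation points $Y=(y_i)_{i=1}^M$ in $\overline\Omega$ let $L=L(Y,X)\in\mathbb{R}^{M\times N}$; assume that $L$ has full column rank, and let $L^+=(L^TL)^{-1}L^T$. The scheme is a *collocation* scheme if the nodes are distinct and lie in $\overline\Omega$, $J_j=\{k: x_k\in\Omega_j\}$, and $Y$ equals $X$ up to ordering. It is a *least squares*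 scheme if each $k$ lies in exactly one $J_j$. **Solution.** Let $U\in\mathbb{R}^N$ be the computed nodal values, $\tilde u$ the approximation with nodal values $U$, and $r=LU-F(Y)$ the residual. Let $C_M,\delta_M\in\mathbb{R}$, where $\delta_M$ stands for the machine precision. Suppose that * the scheme is a collocation scheme and $\|r\|_\infty\le C_M\delta_M$; or * the scheme is a least squares scheme and $L^Tr=0$ holds up to a rounding error $C_M\delta_M$ in the residual, i.e. $L^T(r-e)=0$ for some $e\in\mathbb{R}^M$ with $\|e\|_\infty\le C_M\delta_M$. **Estimate.** Then $$\|\tilde u-u\|_{L_2(\Omega)}\le C_P\|\mathcal{E}_{\mathcal L}\|_\infty+C_P\,\|L(\cdot,X)L^+\|_\infty\,\bigl(C_M\delta_M+\|\mathcal{E}_{\mathcal L}\|_\infty\bigr),$$ where $\|\mathcal{E}_{\mathcal L}\|_\infty=\sup_{x\in\overline\Omega}|\mathcal{E}_{\mathcal L}(x)|$ and $\|L(\cdot,X)L^+\|_\infty=\sup_{x\in\overline\Omega}\sum_{i=1}^M|(L(x,X)L^+)_i|$. Moreover, if the scheme is a least squares scheme and instead $\|L^Tr\|_\infty\le C_M\delta_M$,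 then the same estimate holds with $C_M$ replaced by $\|L(L^TL)^{-1}\|_\infty C_M$, where the matrix norm is the largest absolute row sum. -/

import Mathlib

open MeasureTheory Matrix
open scoped ENNReal NNReal ContDiff

noncomputable section

namespace RBFPUM

/-- Euclidean space `ℝᵈ`. -/
abbrev E (d : ℕ) : Type := EuclideanSpace ℝ (Fin d)

/-- The functions of class `C^∞` with compact support contained in `Ω`. -/
def IsTestFunction {d : ℕ} (Ω : Set (E d)) (η : E d → ℝ) : Prop :=
  ContDiff ℝ ∞ η ∧ HasCompactSupport η ∧ tsupport η ⊆ Ω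

/-- `g` is the weak derivative `∂_{I 0} ⋯ ∂_{I (k-1)} v` on `Ω`. -/
def IsWeakDeriv {d k : ℕ} (Ω : Set (E d)) (v : E d → ℝ) (I : Fin k → Fin d)
    (g : E d → ℝ) : Prop :=
  LocallyIntegrableOn g Ω ∧
  ∀ η : E d → ℝ, IsTestFunction Ω η →
    ∫ x in Ω, v x * iteratedFDeriv ℝ k η x (fun t => EuclideanSpace.single (I t) (1 : ℝ)) =
      (-1) ^ k * ∫ x in Ω, g x * η x

/-- The Sobolev space `W_p^m(Ω)`: all weak partial derivatives of order at most `m` exist and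
lie in `L_p(Ω)` (order `0` says that the function itself does). -/
def MemSobolev {d : ℕ} (m : ℕ) (p : ℝ≥0∞) (Ω : Set (E d)) (v : E d → ℝ) : Prop :=
  ∀ k ≤ m, ∀ I : Fin k → Fin d, ∃ g : E d → ℝ,
    MemLp g p (volume.restrict Ω) ∧ IsWeakDeriv Ω v I g

/-- `u` solves `-Δu = f` in `Ω` (almost everywhere, with weak second derivatives) and `u = g` on
`∂Ω`. As `u` is continuous on the closure of `Ω`, its boundary values are its values on `∂Ω`. -/
structure SolvesPoisson {d : ℕ} (Ω : Set (E d)) (f g u : E d → ℝ) : Prop where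
  continuousOn : ContinuousOn u (closure Ω)
  pde : ∃ D : Fin d → E d → ℝ, (∀ i, IsWeakDeriv Ω u ![i, i] (D i)) ∧
    ∀ᵐ x ∂(volume.restrict Ω), -∑ i, D i x = f x
  boundary : ∀ x ∈ frontier Ω, u x = g x

open Classical in
/-- The operator `𝓛`: `-Δv` in `Ω` and `v` on `∂Ω`, for `v` of class `C²` near `Ω`. -/
def calL {d : ℕ} (Ω : Set (E d)) (v : E d → ℝ) (x : E d) : ℝ :=
  if x ∈ Ω then -(Laplacian.laplacian v : E d → ℝ) x else v x

open Classical in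
/-- The data `F = 𝓛u` of the Poisson problem: `f` in `Ω` and `g` on `∂Ω`. -/
def data {d : ℕ} (Ω : Set (E d)) (f g : E d → ℝ) (x : E d) : ℝ :=
  if x ∈ Ω then f x else g x

/-- The supremum of `|v|` over `Ω ∪ ∂Ω`. -/
def supNorm {d : ℕ} (Ω : Set (E d)) (v : E d → ℝ) : ℝ≥0∞ :=
  ⨆ x ∈ closure Ω, ‖v x‖ₑ

/-- The data of an RBF partition of unity discretization on `Ω`, with `P` patches, `N` nodes and
`M` evaluation points. -/
structure Scheme (d P N M : ℕ) (Ω : Set (E d)) where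
  /-- the patches, an open cover of `Ω ∪ ∂Ω` -/
  patch : Fin P → Set (E d)
  isOpen_patch : ∀ j, IsOpen (patch j)
  cover : closure Ω ⊆ ⋃ j, patch j
  /-- the partition of unity weight functions -/
  w : Fin P → E d → ℝ
  contDiffOn_w : ∀ j, ContDiffOn ℝ 2 (w j) (⋃ i, patch i)
  w_eq_zero : ∀ j, ∀ x, x ∉ patch j → w j x = 0
  sum_w : ∀ x ∈ closure Ω, ∑ j, w j x = 1
  /-- the radial basis function -/
  phi : ℝ → ℝ
  contDiff_phi : ContDiff ℝ 2 (fun x : E d => phi ‖x‖)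
  /-- the nodes; they may lie outside `Ω` -/
  X : Fin N → E d
  /-- the indices of the nodes that belong to patch `j` -/
  J : Fin P → Finset (Fin N)
  /-- the local interpolation matrices `φ(X_j, X_j)` are nonsingular -/
  nonsingular : ∀ j, IsUnit (Matrix.of fun i k : J j => phi ‖X i - X k‖).det
  /-- the evaluation points -/
  Y : Fin M → E d
  Y_mem : ∀ i, Y i ∈ closure Ω

namespace Scheme

variable {d P N M : ℕ} {Ω : Set (E d)} (S : Scheme d P N M Ω)

/-- Collocation: one global set of distinct nodes in `Ω ∪ ∂Ω`, whose points in a patch are the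
local nodes of that patch, and the evaluation points are the nodes. -/
def IsCollocation : Prop :=
  Function.Injective S.X ∧ (∀ k, S.X k ∈ closure Ω) ∧
  (∀ j k, k ∈ S.J j ↔ S.X k ∈ S.patch j) ∧
  ∃ e : Fin M ≃ Fin N, ∀ i, S.Y i = S.X (e i)

/-- Least squares: each patch has its own nodes and its own unknowns, and the global set of
unknowns is the disjoint union of the local ones; the evaluation points are independent of the
nodes. -/
def IsLeastSquares : Prop :=
  ∀ k, ∃! j, k ∈ S.J j

/-- The local interpolation matrix `φ(X_j, X_j)`. -/
def A (j : Fin P) : Matrix (S.J j) (S.J j) ℝ :=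
  Matrix.of fun i k => S.phi ‖S.X i - S.X k‖

/-- The local cardinal functions, `ψ(x, X_j) = φ(x, X_j) φ(X_j, X_j)⁻¹`. -/
def psi (j : Fin P) (x : E d) : S.J j → ℝ :=
  (fun i : S.J j => S.phi ‖x - S.X i‖) ᵥ* (S.A j)⁻¹

/-- The local RBF approximation with nodal values `V` on patch `j`. -/
def localApprox (V : Fin N → ℝ) (j : Fin P) (x : E d) : ℝ :=
  ∑ k : S.J j, S.psi j x k * V k

/-- The global RBF-PUM approximation with nodal values `V`. -/
def approx (V : Fin N → ℝ) (x : E d) : ℝ :=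
  ∑ j, S.w j x * S.localApprox V j x

/-- The RBF-PUM interpolant of `u`. -/
def interp (u : E d → ℝ) : E d → ℝ :=
  S.approx fun k => u (S.X k)

/-- The row vector `L(x, X)`, assembled patch by patch from `𝓛(w_j(x) φ(x, X_j)) φ(X_j, X_j)⁻¹`. -/
def Lrow (x : E d) (k : Fin N) : ℝ :=
  ∑ j, if h : k ∈ S.J j then calL Ω (fun y => S.w j y * S.psi j y ⟨k, h⟩) x else 0

/-- The global matrix `L = L(Y, X)`. -/
def L : Matrix (Fin M) (Fin N) ℝ :=
  Matrix.of fun i k => S.Lrow (S.Y i) k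

/-- The pseudo-inverse `L⁺ = (LᵀL)⁻¹Lᵀ`, for `L` of full column rank. -/
def Lplus : Matrix (Fin N) (Fin M) ℝ :=
  (S.Lᵀ * S.L)⁻¹ * S.Lᵀ

/-- The residual `r_U = L U - F(Y)`. -/
def residual (f g : E d → ℝ) (U : Fin N → ℝ) : Fin M → ℝ :=
  fun i => (S.L *ᵥ U) i - data Ω f g (S.Y i)

/-- The error `𝓔 = 𝓛(I(u) - u) = 𝓛(I(u)) - F` of the interpolant under the operator `𝓛`, where
`F = 𝓛u` is the data of the problem that `u` solves. -/
def interpError (f g u : E d → ℝ) (x : E d) : ℝ :=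
  calL Ω (S.interp u) x - data Ω f g x

/-- The stability norm `‖L(·, X) L⁺‖_∞`, the norm of `r ↦ L(·, X) L⁺ r` as an operator from `ℝᴹ`
with the maximum norm to functions on `Ω ∪ ∂Ω` with the supremum norm. -/
def stabilityNorm : ℝ≥0∞ :=
  ⨆ x ∈ closure Ω, ∑ i, ‖(S.Lrow x ᵥ* S.Lplus) i‖ₑ

/-- The right-hand side of the error estimate, with rounding error `τ`. -/
def errorBound (CP : ℝ≥0) (f g u : E d → ℝ) (τ : ℝ) : ℝ≥0∞ :=
  CP * supNorm Ω (S.interpError f g u) +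
    CP * S.stabilityNorm * (ENNReal.ofReal τ + supNorm Ω (S.interpError f g u))

end Scheme

/-- The relation `Aᵀ r = 0` holds up to a rounding error of size `τ` in the vector `r`
(`‖·‖` on `ℝᴹ` is the maximum norm). -/
def OrthogonalUpTo {M N : ℕ} (A : Matrix (Fin M) (Fin N) ℝ) (r : Fin M → ℝ) (τ : ℝ) : Prop :=
  ∃ e : Fin M → ℝ, ‖e‖ ≤ τ ∧ Aᵀ *ᵥ (r - e) = 0

/-- The matrix norm induced by the maximum norms: the largest absolute row sum. -/
def rowSumNorm {M N : ℕ} (A : Matrix (Fin M) (Fin N) ℝ) : ℝ≥0 :=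
  Finset.univ.sup fun i => ∑ k, ‖A i k‖₊

end RBFPUM

end

/-! The proof is a stability estimate for the Poisson problem combined with finite-dimensional
algebra. Write `ũ = S.approx U` and let `V` be the nodal values of `u`.

Stability: `v = ũ - u` has weak Laplacian `-(𝓛ũ - F)` in `Ω` and boundary values `𝓛ũ - F`. If `Ω`
lies in a ball of radius `R` about `0`, comparison with a paraboloid gives `|v| ≤ (1 + R²) ‖𝓛ũ -
F‖_∞`. Integration over `Ω` costs `|Ω|^(1/2)`, so `C_P = |Ω|^(1/2) (1 + R²)`. No regularity of the
boundary enters, because `v` is continuous up to it. Since `u` has only weak second derivatives, the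
maximum principle is proved by mollification (`HasWeakLaplacian.not_lt_on_sphere`,
`HasWeakLaplacian.abs_le_of_frontier`).

Algebra: `𝓛ũ - F = 𝓔 + L(·,X)(U - V)` and `L(U - V) = r - 𝓔(Y)`. If `Lᵀ(r - e) = 0`, then `L⁺r =
L⁺e`, and `L⁺L = 1` gives `U - V = L⁺(e - 𝓔(Y))` (`Scheme.calL_approx_sub_data`). The three rounding
models differ only in the choice of `e`. -/

noncomputable section

namespace RBFPUM

variable {d : ℕ} {Ω : Set (E d)}

/-! ### Second derivatives, supports and integrability. -/

/-- The Laplacian is the trace of the second derivative. -/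
theorem laplacian_eq_sum_fderiv_fderiv (v : E d → ℝ) (x : E d) :
    (Laplacian.laplacian v : E d → ℝ) x =
      ∑ i, fderiv ℝ (fderiv ℝ v) x (EuclideanSpace.single i 1) (EuclideanSpace.single i 1) := by
  rw [InnerProductSpace.laplacian_eq_iteratedFDeriv_orthonormalBasis v
    (EuclideanSpace.basisFun (Fin d) ℝ)]
  simp [iteratedFDeriv_two_apply]

/-- Only the compact set `tsupport b` matters, and `h` is integrable there. This lets integrals
against test functions be taken over the whole space. -/
theorem integrable_mul_of_tsupport_subset {h b : E d → ℝ}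
    (hh : LocallyIntegrableOn h Ω) (hb : Continuous b) (hc : HasCompactSupport b)
    (hs : tsupport b ⊆ Ω) : Integrable fun x => h x * b x := by
  have h1 : IntegrableOn (fun x => h x * b x) (tsupport b) :=
    (hh.integrableOn_compact_subset hs hc).mul_continuousOn hb.continuousOn hc
  refine (integrableOn_iff_integrable_of_support_subset ?_).1 h1
  intro x hx
  apply subset_tsupport
  intro h0
  exact hx (by simp [h0])

theorem tsupport_fderiv_apply_subset (v : E d → ℝ) (e : E d) :
    tsupport (fun x => fderiv ℝ v x e) ⊆ tsupport v := by
  refine (closure_mono ?_).trans (tsupport_fderiv_subset ℝ (f := v))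
  intro x hx h0
  exact hx (by simp [h0])

theorem tsupport_fderiv_fderiv_apply_subset (v : E d → ℝ) (e : E d) :
    tsupport (fun x => fderiv ℝ (fderiv ℝ v) x e e) ⊆ tsupport v := by
  refine (closure_mono ?_).trans
    ((tsupport_fderiv_subset ℝ (f := fderiv ℝ v)).trans (tsupport_fderiv_subset ℝ (f := v)))
  intro x hx h0
  exact hx (by simp [h0])

theorem fderiv_fderiv_apply {v : E d → ℝ} {x : E d} (hv : ContDiffAt ℝ 2 v x) (e e' : E d) :
    fderiv ℝ (fun y => fderiv ℝ v y e) x e' = fderiv ℝ (fderiv ℝ v) x e' e := by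
  have h : DifferentiableAt ℝ (fderiv ℝ v) x :=
    (hv.fderiv_right (m := 1) (by norm_num)).differentiableAt (by norm_num)
  rw [fderiv_clm_apply h (differentiableAt_const e)]
  simp

theorem tsupport_laplacian_subset (v : E d → ℝ) :
    tsupport (Laplacian.laplacian v : E d → ℝ) ⊆ tsupport v := by
  refine closure_minimal ?_ (isClosed_tsupport v)
  intro x hx
  by_contra hn
  apply hx
  have h1 : fderiv ℝ (fderiv ℝ v) x = 0 := by
    by_contra h2
    exact hn (tsupport_fderiv_subset ℝ (tsupport_fderiv_subset ℝ (subset_tsupport _ h2)))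
  simp [laplacian_eq_sum_fderiv_fderiv, h1]

theorem continuousAt_laplacian {v : E d → ℝ} {x : E d} (hv : ContDiffAt ℝ 2 v x) :
    ContinuousAt (Laplacian.laplacian v : E d → ℝ) x := by
  have h : ContinuousAt (fderiv ℝ (fderiv ℝ v)) x :=
    ((hv.fderiv_right (m := 1) (by norm_num)).fderiv_right (m := 0) (by norm_num)).continuousAt
  have e : (Laplacian.laplacian v : E d → ℝ) = fun x =>
      ∑ i, fderiv ℝ (fderiv ℝ v) x (EuclideanSpace.single i 1) (EuclideanSpace.single i 1) :=
    funext (laplacian_eq_sum_fderiv_fderiv v)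
  rw [e]
  fun_prop

theorem IsTestFunction.contDiff_two {η : E d → ℝ} (hη : IsTestFunction Ω η) : ContDiff ℝ 2 η :=
  hη.1.of_le (WithTop.coe_le_coe.2 le_top)

theorem IsTestFunction.continuous_laplacian {η : E d → ℝ} (hη : IsTestFunction Ω η) :
    Continuous (Laplacian.laplacian η : E d → ℝ) :=
  continuous_iff_continuousAt.2 fun _ =>
    continuousAt_laplacian hη.contDiff_two.contDiffAt

/-! ### Weak Laplacians. -/

/-- Integration by parts, twice, against a test function. -/
theorem integral_mul_fderiv_fderiv {a η : E d → ℝ} (hΩ : IsOpen Ω) (ha : ContDiffOn ℝ 2 a Ω)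
    (hη : IsTestFunction Ω η) (e : E d) :
    ∫ x, a x * fderiv ℝ (fderiv ℝ η) x e e = ∫ x, fderiv ℝ (fderiv ℝ a) x e e * η x := by
  have ha' : ∀ x ∈ Ω, ContDiffAt ℝ 2 a x := fun x hx => ha.contDiffAt (hΩ.mem_nhds hx)
  have hη2 : ContDiff ℝ 2 η := hη.contDiff_two
  set b : E d → ℝ := fun x => fderiv ℝ η x e
  set c : E d → ℝ := fun x => fderiv ℝ a x e
  have hb : ContDiff ℝ 1 b := (hη2.fderiv_right (m := 1) (by norm_num)).clm_apply contDiff_const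
  have hc : ∀ x ∈ Ω, ContDiffAt ℝ 1 c x := fun x hx =>
    ((ha' x hx).fderiv_right (m := 1) (by norm_num)).clm_apply contDiffAt_const
  have hbs : tsupport b ⊆ tsupport η := tsupport_fderiv_apply_subset η e
  have hbc : HasCompactSupport b := hη.2.1.of_isClosed_subset (isClosed_tsupport b) hbs
  have hb's : tsupport (fun x => fderiv ℝ b x e) ⊆ tsupport η :=
    (tsupport_fderiv_apply_subset b e).trans hbs
  have hb'c : HasCompactSupport (fun x => fderiv ℝ b x e) :=
    hη.2.1.of_isClosed_subset (isClosed_tsupport _) hb's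
  have hb'cont : Continuous (fun x => fderiv ℝ b x e) :=
    (hb.continuous_fderiv (by norm_num)).clm_apply continuous_const
  have la : LocallyIntegrableOn a Ω :=
    ha.continuousOn.locallyIntegrableOn hΩ.measurableSet
  have lc : LocallyIntegrableOn c Ω :=
    ContinuousOn.locallyIntegrableOn
      (fun x hx => (hc x hx).continuousAt.continuousWithinAt) hΩ.measurableSet
  have lc' : LocallyIntegrableOn (fun x => fderiv ℝ c x e) Ω := by
    refine ContinuousOn.locallyIntegrableOn (fun x hx => ?_) hΩ.measurableSet
    have := ((hc x hx).fderiv_right (m := 0) (by norm_num)).continuousAt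
    exact (this.clm_apply continuousAt_const).continuousWithinAt
  have h1 : ∫ x, a x * fderiv ℝ b x e = -∫ x, c x * b x :=
    integral_mul_fderiv_eq_neg_fderiv_mul_of_integrable
      (integrable_mul_of_tsupport_subset lc hb.continuous hbc (hbs.trans hη.2.2))
      (integrable_mul_of_tsupport_subset la hb'cont hb'c (hb's.trans hη.2.2))
      (integrable_mul_of_tsupport_subset la hb.continuous hbc (hbs.trans hη.2.2))
      (fun x hx => (ha' x (hη.2.2 (hbs hx))).differentiableAt (by norm_num))
      (fun x _ => hb.differentiable (by norm_num) x)
  have h2 : ∫ x, c x * b x = -∫ x, fderiv ℝ c x e * η x :=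
    integral_mul_fderiv_eq_neg_fderiv_mul_of_integrable
      (integrable_mul_of_tsupport_subset lc' hη2.continuous hη.2.1 hη.2.2)
      (integrable_mul_of_tsupport_subset lc hb.continuous hbc (hbs.trans hη.2.2))
      (integrable_mul_of_tsupport_subset lc hη2.continuous hη.2.1 hη.2.2)
      (fun x hx => (hc x (hη.2.2 hx)).differentiableAt (by norm_num))
      (fun x _ => hη2.differentiable (by norm_num) x)
  rw [h2, neg_neg] at h1
  have e1 : ∀ x, fderiv ℝ (fderiv ℝ η) x e e = fderiv ℝ b x e := fun x =>
    (fderiv_fderiv_apply hη2.contDiffAt e e).symm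
  simp_rw [e1, h1]
  -- Outside `Ω` the derivatives of `a` carry no information, but there `η` vanishes.
  refine integral_congr_ae (Filter.Eventually.of_forall fun x => ?_)
  by_cases hx : x ∈ Ω
  · simp only [c]
    rw [fderiv_fderiv_apply (ha' x hx)]
  · have : η x = 0 := image_eq_zero_of_notMem_tsupport fun h => hx (hη.2.2 h)
    simp [this]

/-- `h` is the Laplacian of `z` on `Ω` in the sense of distributions, for `z` continuous. -/
structure HasWeakLaplacian (Ω : Set (E d)) (z h : E d → ℝ) : Prop where
  continuousOn : ContinuousOn z Ω
  locallyIntegrableOn : LocallyIntegrableOn h Ω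
  integral_eq : ∀ η : E d → ℝ, IsTestFunction Ω η →
    ∫ x in Ω, z x * (Laplacian.laplacian η : E d → ℝ) x = ∫ x in Ω, h x * η x

theorem IsTestFunction.integrable_mul {η h : E d → ℝ} (hη : IsTestFunction Ω η)
    (hh : LocallyIntegrableOn h Ω) : Integrable fun x => h x * η x :=
  integrable_mul_of_tsupport_subset hh hη.1.continuous hη.2.1 hη.2.2

theorem IsTestFunction.integrable_mul_laplacian {η h : E d → ℝ} (hη : IsTestFunction Ω η)
    (hh : LocallyIntegrableOn h Ω) :
    Integrable fun x => h x * (Laplacian.laplacian η : E d → ℝ) x :=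
  integrable_mul_of_tsupport_subset hh hη.continuous_laplacian
    (hη.2.1.of_isClosed_subset (isClosed_tsupport _) (tsupport_laplacian_subset η))
    ((tsupport_laplacian_subset η).trans hη.2.2)

theorem hasWeakLaplacian_of_contDiffOn {a : E d → ℝ} (hΩ : IsOpen Ω) (ha : ContDiffOn ℝ 2 a Ω) :
    HasWeakLaplacian Ω a (Laplacian.laplacian a) := by
  have lap : ContinuousOn (Laplacian.laplacian a : E d → ℝ) Ω := fun x hx =>
    (continuousAt_laplacian (ha.contDiffAt (hΩ.mem_nhds hx))).continuousWithinAt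
  refine ⟨ha.continuousOn, lap.locallyIntegrableOn hΩ.measurableSet, fun η hη => ?_⟩
  have hη2 : ContDiff ℝ 2 η := hη.contDiff_two
  have z : ∀ x, x ∉ Ω → η x = 0 := fun x hx =>
    image_eq_zero_of_notMem_tsupport fun h => hx (hη.2.2 h)
  have z' : ∀ x, x ∉ Ω → (Laplacian.laplacian η : E d → ℝ) x = 0 := fun x hx =>
    image_eq_zero_of_notMem_tsupport fun h => hx (hη.2.2 (tsupport_laplacian_subset η h))
  rw [setIntegral_eq_integral_of_forall_compl_eq_zero fun x hx => by simp [z' x hx],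
    setIntegral_eq_integral_of_forall_compl_eq_zero fun x hx => by simp [z x hx]]
  simp_rw [laplacian_eq_sum_fderiv_fderiv, Finset.mul_sum, Finset.sum_mul]
  have c2 : Continuous (fderiv ℝ (fderiv ℝ η)) :=
    (hη2.fderiv_right (m := 1) (by norm_num)).continuous_fderiv (by norm_num)
  rw [integral_finsetSum, integral_finsetSum]
  · exact Finset.sum_congr rfl fun i _ => integral_mul_fderiv_fderiv hΩ ha hη _
  · intro i _
    refine hη.integrable_mul (ContinuousOn.locallyIntegrableOn (fun x hx => ?_)
      hΩ.measurableSet)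
    have := (((ha.contDiffAt (hΩ.mem_nhds hx)).fderiv_right (m := 1) (by norm_num)).fderiv_right
      (m := 0) (by norm_num)).continuousAt
    exact ((this.clm_apply continuousAt_const).clm_apply continuousAt_const).continuousWithinAt
  · intro i _
    have s3 := tsupport_fderiv_fderiv_apply_subset η (EuclideanSpace.single i 1)
    exact integrable_mul_of_tsupport_subset
      (ha.continuousOn.locallyIntegrableOn hΩ.measurableSet)
      ((c2.clm_apply continuous_const).clm_apply continuous_const)
      (hη.2.1.of_isClosed_subset (isClosed_tsupport _) s3) (s3.trans hη.2.2)

theorem hasWeakLaplacian_of_isWeakDeriv {u : E d → ℝ} {D : Fin d → E d → ℝ} (hΩ : IsOpen Ω)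
    (hu : ContinuousOn u Ω) (hD : ∀ i, IsWeakDeriv Ω u ![i, i] (D i)) :
    HasWeakLaplacian Ω u (fun x => ∑ i, D i x) := by
  have lD : LocallyIntegrableOn (fun x => ∑ i, D i x) Ω := by
    intro x hx
    choose s hs using fun i => (hD i).1 x hx
    refine ⟨⋂ i, s i, by simpa using fun i => (hs i).1, ?_⟩
    exact integrable_finsetSum _ fun i _ => (hs i).2.mono_set (Set.iInter_subset _ i)
  refine ⟨hu, lD, fun η hη => ?_⟩
  have hη2 : ContDiff ℝ 2 η := hη.contDiff_two
  have c2 : Continuous (fderiv ℝ (fderiv ℝ η)) :=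
    (hη2.fderiv_right (m := 1) (by norm_num)).continuous_fderiv (by norm_num)
  simp_rw [laplacian_eq_sum_fderiv_fderiv, Finset.mul_sum, Finset.sum_mul]
  rw [integral_finsetSum, integral_finsetSum]
  · refine Finset.sum_congr rfl fun i _ => ?_
    have := (hD i).2 η hη
    simpa [iteratedFDeriv_two_apply] using this
  · exact fun i _ => (hη.integrable_mul (hD i).1).integrableOn
  · intro i _
    have s3 := tsupport_fderiv_fderiv_apply_subset η (EuclideanSpace.single i 1)
    exact (integrable_mul_of_tsupport_subset
      (hu.locallyIntegrableOn hΩ.measurableSet)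
      ((c2.clm_apply continuous_const).clm_apply continuous_const)
      (hη.2.1.of_isClosed_subset (isClosed_tsupport _) s3) (s3.trans hη.2.2)).integrableOn

theorem HasWeakLaplacian.add {z h z' h' : E d → ℝ} (hΩ : IsOpen Ω) (H : HasWeakLaplacian Ω z h)
    (H' : HasWeakLaplacian Ω z' h') :
    HasWeakLaplacian Ω (fun x => z x + z' x) (fun x => h x + h' x) := by
  refine ⟨H.continuousOn.add H'.continuousOn,
    H.locallyIntegrableOn.add H'.locallyIntegrableOn, fun η hη => ?_⟩
  simp_rw [add_mul]
  rw [integral_add, integral_add, H.integral_eq η hη, H'.integral_eq η hη]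
  · exact (hη.integrable_mul H.locallyIntegrableOn).integrableOn
  · exact (hη.integrable_mul H'.locallyIntegrableOn).integrableOn
  · exact (hη.integrable_mul_laplacian
      (H.continuousOn.locallyIntegrableOn hΩ.measurableSet)).integrableOn
  · exact (hη.integrable_mul_laplacian
      (H'.continuousOn.locallyIntegrableOn hΩ.measurableSet)).integrableOn

theorem HasWeakLaplacian.neg {z h : E d → ℝ} (H : HasWeakLaplacian Ω z h) :
    HasWeakLaplacian Ω (fun x => -z x) (fun x => -h x) := by
  refine ⟨H.continuousOn.neg, H.locallyIntegrableOn.neg, fun η hη => ?_⟩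
  simp_rw [neg_mul, integral_neg, H.integral_eq η hη]

theorem HasWeakLaplacian.sub {z h z' h' : E d → ℝ} (hΩ : IsOpen Ω) (H : HasWeakLaplacian Ω z h)
    (H' : HasWeakLaplacian Ω z' h') :
    HasWeakLaplacian Ω (fun x => z x - z' x) (fun x => h x - h' x) := by
  simpa [sub_eq_add_neg] using H.add hΩ H'.neg

/-! ### Interior maxima and mollification. -/

theorem fderiv_fderiv_nonpos_of_isLocalMax {v : E d → ℝ} {x : E d} (hv : ContDiff ℝ 2 v)
    (hx : IsLocalMax v x) (e : E d) : fderiv ℝ (fderiv ℝ v) x e e ≤ 0 := by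
  by_contra! hpos
  have hline : ∀ t : ℝ, HasDerivAt (fun t : ℝ => x + t • e) e t := fun t => by
    simpa using ((hasDerivAt_id t).smul_const e).const_add x
  have h1 : deriv (fun t : ℝ => v (x + t • e)) = fun t => fderiv ℝ v (x + t • e) e := by
    funext t
    exact ((hv.differentiable (by norm_num) _).hasFDerivAt.comp_hasDerivAt t (hline t)).deriv
  have hb : ContDiff ℝ 1 (fun y => fderiv ℝ v y e) :=
    (hv.fderiv_right (m := 1) (by norm_num)).clm_apply contDiff_const
  have h2 : deriv (deriv fun t : ℝ => v (x + t • e)) 0 = fderiv ℝ (fderiv ℝ v) x e e := by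
    rw [h1, ← fderiv_fderiv_apply hv.contDiffAt]
    simpa [Function.comp_def] using
      ((hb.differentiable (by norm_num) _).hasFDerivAt.comp_hasDerivAt 0 (hline 0)).deriv
  have hcont : ContinuousAt (fun t : ℝ => x + t • e) 0 := (hline 0).continuousAt
  have hmax : IsLocalMax (fun t : ℝ => v (x + t • e)) 0 := by
    have h0 : Filter.Tendsto (fun t : ℝ => x + t • e) (nhds 0) (nhds x) := by
      simpa [ContinuousAt] using hcont
    filter_upwards [h0.eventually hx] with t ht
    simpa using ht
  -- A positive second derivative would make the local maximum along the line a local minimum as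
  -- well. The restriction would then be locally constant, with second derivative zero.
  have hmin : IsLocalMin (fun t : ℝ => v (x + t • e)) 0 :=
    isLocalMin_of_deriv_deriv_pos (by rw [h2]; exact hpos) hmax.deriv_eq_zero
      ((hv.continuous.comp (continuous_const.add (continuous_id.smul continuous_const))).continuousAt)
  have hconst : (fun t : ℝ => v (x + t • e)) =ᶠ[nhds 0] fun _ => v (x + (0 : ℝ) • e) := by
    filter_upwards [hmax, hmin] with t h3 h4 using le_antisymm h3 h4
  have h5 := hconst.deriv.deriv_eq
  rw [h2] at h5
  simp at h5
  exact hpos.ne' h5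

theorem laplacian_nonpos_of_isLocalMax {v : E d → ℝ} {x : E d} (hv : ContDiff ℝ 2 v)
    (hx : IsLocalMax v x) : (Laplacian.laplacian v : E d → ℝ) x ≤ 0 := by
  rw [laplacian_eq_sum_fderiv_fderiv]
  exact Finset.sum_nonpos fun i _ => fderiv_fderiv_nonpos_of_isLocalMax hv hx _

open scoped Convolution in
theorem fderiv_convolution_apply {g φ : E d → ℝ} (hg : LocallyIntegrable g)
    (hφ : ContDiff ℝ 1 φ) (hc : HasCompactSupport φ) (e : E d) :
    (fun x => fderiv ℝ (g ⋆[ContinuousLinearMap.mul ℝ ℝ] φ) x e) =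
      g ⋆[ContinuousLinearMap.mul ℝ ℝ] fun y => fderiv ℝ φ y e := by
  funext x
  rw [(hc.hasFDerivAt_convolution_right (ContinuousLinearMap.mul ℝ ℝ) hg hφ x).fderiv]
  exact convolution_precompR_apply (ContinuousLinearMap.mul ℝ ℝ) hg
    (hc.fderiv ℝ) (hφ.continuous_fderiv (by norm_num)) x e

theorem fderiv_fderiv_comp_const_sub {φ : E d → ℝ} (hφ : ContDiff ℝ 2 φ) (x t e : E d) :
    fderiv ℝ (fderiv ℝ fun y => φ (x - y)) t e e = fderiv ℝ (fderiv ℝ φ) (x - t) e e := by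
  have hs : ∀ t : E d, HasFDerivAt (fun y : E d => x - y) (-ContinuousLinearMap.id ℝ (E d)) t :=
    fun t => by simpa using (hasFDerivAt_id t).const_sub x
  have hη : ContDiff ℝ 2 fun y => φ (x - y) := hφ.comp (contDiff_const.sub contDiff_id)
  have hb : ContDiff ℝ 1 (fun y => fderiv ℝ φ y e) :=
    (hφ.fderiv_right (m := 1) (by norm_num)).clm_apply contDiff_const
  have h1 : (fun t => fderiv ℝ (fun y => φ (x - y)) t e) = fun t => -fderiv ℝ φ (x - t) e := by
    funext t
    have := ((hφ.differentiable (by norm_num) (x - t)).hasFDerivAt.comp t (hs t)).fderiv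
    rw [Function.comp_def] at this
    rw [this]
    simp
  rw [← fderiv_fderiv_apply hη.contDiffAt, h1, ← fderiv_fderiv_apply hφ.contDiffAt]
  have := ((hb.differentiable (by norm_num) (x - t)).hasFDerivAt.comp t (hs t)).neg.fderiv
  have h2 : (fun t => -fderiv ℝ φ (x - t) e) =
    -((fun y => fderiv ℝ φ y e) ∘ fun y => x - y) := rfl
  rw [h2, this]
  simp

open scoped Convolution in
-- All derivatives fall on `φ`, and the reflection `t ↦ x - t` preserves second derivatives. The
-- right-hand side pairs `g` with the Laplacian of `φ (x - ·)`, the form in which a weak Laplacian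
-- can be used.
theorem laplacian_convolution {g φ : E d → ℝ} (hg : LocallyIntegrable g)
    (hφ : ContDiff ℝ 2 φ) (hc : HasCompactSupport φ) (x : E d) :
    (Laplacian.laplacian (g ⋆[ContinuousLinearMap.mul ℝ ℝ] φ) : E d → ℝ) x =
      ∫ t, g t * (Laplacian.laplacian (fun y => φ (x - y)) : E d → ℝ) t := by
  have hG : ContDiff ℝ 2 (g ⋆[ContinuousLinearMap.mul ℝ ℝ] φ) :=
    hc.contDiff_convolution_right (n := 2) (ContinuousLinearMap.mul ℝ ℝ) hg hφ
  have c2 : Continuous (fderiv ℝ (fderiv ℝ φ)) :=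
    (hφ.fderiv_right (m := 1) (by norm_num)).continuous_fderiv (by norm_num)
  simp_rw [laplacian_eq_sum_fderiv_fderiv, fderiv_fderiv_comp_const_sub hφ, Finset.mul_sum]
  rw [integral_finsetSum]
  · refine Finset.sum_congr rfl fun i _ => ?_
    set e : E d := EuclideanSpace.single i 1
    have hb : ContDiff ℝ 1 (fun y => fderiv ℝ φ y e) :=
      (hφ.fderiv_right (m := 1) (by norm_num)).clm_apply contDiff_const
    have hbc : HasCompactSupport (fun y => fderiv ℝ φ y e) :=
      hc.of_isClosed_subset (isClosed_tsupport _) (tsupport_fderiv_apply_subset φ e)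
    rw [← fderiv_fderiv_apply hG.contDiffAt,
      fderiv_convolution_apply hg (hφ.of_le (by norm_num)) hc]
    have := congrFun (fderiv_convolution_apply hg hb hbc e) x
    rw [this, convolution_def]
    simp_rw [fderiv_fderiv_apply hφ.contDiffAt]
    rfl
  · intro i _
    set e : E d := EuclideanSpace.single i 1
    have hcc : HasCompactSupport (fun y => fderiv ℝ (fderiv ℝ φ) y e e) :=
      hc.of_isClosed_subset (isClosed_tsupport _) (tsupport_fderiv_fderiv_apply_subset φ e)
    have := hcc.convolutionExists_right (ContinuousLinearMap.mul ℝ ℝ) hg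
      ((c2.clm_apply continuous_const).clm_apply continuous_const) x
    exact this

open scoped Convolution in
/-- A continuous function whose weak Laplacian is bounded below by a positive constant has no
strict interior maximum. -/
theorem HasWeakLaplacian.not_lt_on_sphere {z h : E d → ℝ} {x₀ : E d} {r c : ℝ} (hd : 0 < d)
    (H : HasWeakLaplacian Ω z h) (hc : 0 < c) (hh : ∀ᵐ x ∂(volume.restrict Ω), c ≤ h x)
    (hr : 0 < r) (hball : Metric.closedBall x₀ (2 * r) ⊆ Ω)
    (hlt : ∀ x ∈ Metric.sphere x₀ r, z x < z x₀) : False := by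
  have : Nonempty (Fin d) := ⟨⟨0, hd⟩⟩
  have hBc : IsCompact (Metric.closedBall x₀ (2 * r)) := isCompact_closedBall _ _
  have hzB : ContinuousOn z (Metric.closedBall x₀ (2 * r)) := H.continuousOn.mono hball
  have hsub : Metric.closedBall x₀ r ⊆ Metric.closedBall x₀ (2 * r) :=
    Metric.closedBall_subset_closedBall (by linarith)
  -- the gap between the centre and the sphere
  obtain ⟨γ, hγ, hgap⟩ : ∃ γ > 0, ∀ x ∈ Metric.sphere x₀ r, z x + 3 * γ ≤ z x₀ := by
    have hne : (Metric.sphere x₀ r).Nonempty := by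
      have : Nontrivial (E d) := inferInstance
      exact NormedSpace.sphere_nonempty.2 hr.le
    obtain ⟨y, hy, hmax⟩ := (isCompact_sphere x₀ r).exists_isMaxOn hne
      (hzB.mono (Metric.sphere_subset_closedBall.trans hsub))
    refine ⟨(z x₀ - z y) / 3, by linarith [hlt y hy], fun x hx => ?_⟩
    have : z x ≤ z y := hmax hx
    linarith
  obtain ⟨δ, hδ, hunif⟩ := Metric.uniformContinuousOn_iff.1
    (hBc.uniformContinuousOn_of_continuous hzB) γ hγ
  set ε := min δ r with hε
  have hε0 : 0 < ε := lt_min hδ hr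
  let φ : ContDiffBump (0 : E d) := ⟨ε / 2, ε, by linarith, by linarith⟩
  -- The cutoff makes `z` globally integrable. For centres within `r` of `x₀`, the mollifier, of
  -- radius `ε ≤ r`, never sees it.
  set g : E d → ℝ := (Metric.closedBall x₀ (2 * r)).indicator z with hg
  have hgi : Integrable g :=
    (integrable_indicator_iff Metric.isClosed_closedBall.measurableSet).2
      (hzB.integrableOn_compact hBc)
  have hgl : LocallyIntegrable g := hgi.locallyIntegrable
  have hgz : ∀ x ∈ Metric.closedBall x₀ (2 * r), g x = z x := fun x hx =>
    Set.indicator_of_mem hx z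
  set ψ : E d → ℝ := φ.normed volume with hψ
  have hψc : HasCompactSupport ψ := φ.hasCompactSupport_normed
  have hψs : ContDiff ℝ ∞ ψ := φ.contDiff_normed
  have hψ2 : ContDiff ℝ 2 ψ := hψs.of_le (WithTop.coe_le_coe.2 le_top)
  set G : E d → ℝ := g ⋆[ContinuousLinearMap.mul ℝ ℝ] ψ with hGdef
  have hG : ContDiff ℝ 2 G :=
    hψc.contDiff_convolution_right (n := 2) (ContinuousLinearMap.mul ℝ ℝ) hgl hψ2
  -- The approximation bound for bump functions has the bump as left factor; the derivative formulas
  -- have it on the right.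
  have hGflip : G = ψ ⋆[ContinuousLinearMap.lsmul ℝ ℝ] g := by
    rw [hGdef, ← convolution_flip]
    congr 1
    ext
    simp
  have hmem : ∀ x ∈ Metric.closedBall x₀ r, ∀ y, dist y x ≤ ε →
      y ∈ Metric.closedBall x₀ (2 * r) := fun x hx y hy => by
    rw [Metric.mem_closedBall] at hx ⊢
    have := dist_triangle y x x₀
    have : ε ≤ r := min_le_right _ _
    linarith
  have happ : ∀ x ∈ Metric.closedBall x₀ r, |G x - z x| ≤ γ := fun x hx => by
    have := φ.dist_normed_convolution_le (μ := volume) (x₀ := x) (ε := γ)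
      hgi.aestronglyMeasurable (fun y hy => ?_)
    · rw [← Real.dist_eq, hGflip]
      rwa [hgz x (hsub hx)] at this
    · have hy' : dist y x < ε := hy
      have hyB := hmem x hx y hy'.le
      rw [hgz x (hsub hx), hgz y hyB]
      exact (hunif y hyB x (hsub hx) (hy'.trans_le (min_le_left _ _))).le
  obtain ⟨x₁, hx₁, hmax⟩ := (isCompact_closedBall x₀ r).exists_isMaxOn
    ⟨x₀, Metric.mem_closedBall_self hr.le⟩ hG.continuous.continuousOn
  have hx₁b : x₁ ∈ Metric.ball x₀ r := by
    rw [Metric.mem_ball]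
    refine lt_of_le_of_ne hx₁ fun heq => ?_
    have h0 : G x₀ ≤ G x₁ := hmax (Metric.mem_closedBall_self hr.le)
    have h1 := abs_le.1 (happ x₀ (Metric.mem_closedBall_self hr.le))
    have h2 := abs_le.1 (happ x₁ hx₁)
    have h3 := hgap x₁ heq
    linarith [h1.1, h2.2]
  have hloc : IsLocalMax G x₁ := by
    filter_upwards [Metric.isOpen_ball.mem_nhds hx₁b] with y hy
    exact hmax (Metric.ball_subset_closedBall hy)
  -- The contradiction: this Laplacian equals the integral of `h` against `ψ (x₁ - ·)`, a
  -- nonnegative test function of mass one, hence is at least `c`.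
  have hle := laplacian_nonpos_of_isLocalMax hG hloc
  rw [hGdef, laplacian_convolution hgl hψ2 hψc] at hle
  have hts : tsupport (fun y => ψ (x₁ - y)) ⊆ Metric.closedBall x₀ (2 * r) := by
    refine closure_minimal (fun y hy => hmem x₁ hx₁ y ?_) Metric.isClosed_closedBall
    have : x₁ - y ∈ Function.support ψ := hy
    rw [hψ, φ.support_normed_eq, mem_ball_zero_iff] at this
    rw [dist_comm, dist_eq_norm]
    exact this.le
  have hη : IsTestFunction Ω fun y => ψ (x₁ - y) :=
    ⟨hψs.comp (contDiff_const.sub contDiff_id),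
      hBc.of_isClosed_subset (isClosed_tsupport _) hts, hts.trans hball⟩
  have heq : ∫ t, g t * (Laplacian.laplacian (fun y => ψ (x₁ - y)) : E d → ℝ) t =
      ∫ t in Ω, z t * (Laplacian.laplacian (fun y => ψ (x₁ - y)) : E d → ℝ) t := by
    have hz : ∀ t, t ∉ Metric.closedBall x₀ (2 * r) →
        (Laplacian.laplacian (fun y => ψ (x₁ - y)) : E d → ℝ) t = 0 := fun t ht =>
      image_eq_zero_of_notMem_tsupport fun h => ht (hts (tsupport_laplacian_subset _ h))
    rw [setIntegral_eq_integral_of_forall_compl_eq_zero fun t ht => by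
      simp [hz t fun h => ht (hball h)]]
    refine integral_congr_ae (Filter.Eventually.of_forall fun t => ?_)
    by_cases ht : t ∈ Metric.closedBall x₀ (2 * r)
    · simp [hgz t ht]
    · simp [hz t ht]
  rw [heq, H.integral_eq _ hη] at hle
  have hone : ∫ t in Ω, c * ψ (x₁ - t) = c := by
    rw [setIntegral_eq_integral_of_forall_compl_eq_zero fun t ht => by
      simp [image_eq_zero_of_notMem_tsupport fun h => ht (hη.2.2 h)]]
    rw [integral_const_mul, integral_sub_left_eq_self ψ volume x₁, hψ, φ.integral_normed, mul_one]
  have hmono : ∫ t in Ω, c * ψ (x₁ - t) ≤ ∫ t in Ω, h t * ψ (x₁ - t) := by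
    refine integral_mono_ae ?_ ?_ ?_
    · exact (hη.integrable_mul (h := fun _ => c)
        ((locallyIntegrable_const c).locallyIntegrableOn Ω)).integrableOn
    · exact (hη.integrable_mul H.locallyIntegrableOn).integrableOn
    · filter_upwards [hh] with t ht
      exact mul_le_mul_of_nonneg_right ht (φ.nonneg_normed _)
  linarith

/-! ### Weak maximum principle and a priori bound by paraboloids. -/

theorem laplacian_norm_sub_sq (x₀ x : E d) :
    (Laplacian.laplacian (fun y : E d => ‖y - x₀‖ ^ 2) : E d → ℝ) x = 2 * d := by
  have h1 : fderiv ℝ (fun y : E d => ‖y - x₀‖ ^ 2) = fun y => 2 • innerSL ℝ (y - x₀) := by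
    funext y
    have := ((hasFDerivAt_id (𝕜 := ℝ) y).sub_const x₀).norm_sq.fderiv
    simpa using this
  have h2 : HasFDerivAt (fun y : E d => 2 • innerSL ℝ (y - x₀)) (2 • innerSL ℝ) x := by
    have := ((innerSL ℝ : E d →L[ℝ] _).hasFDerivAt.comp x
      ((hasFDerivAt_id x).sub_const x₀)).const_smul (2 : ℕ)
    exact this
  rw [laplacian_eq_sum_fderiv_fderiv, h1, h2.fderiv]
  have h3 : ∀ e : E d, (2 • innerSL ℝ : E d →L[ℝ] E d →L[ℝ] ℝ) e e = 2 * ‖e‖ ^ 2 := fun e => by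
    simp only [_root_.smul_apply, nsmul_eq_mul, Nat.cast_ofNat]
    exact congrArg (2 * ·) (real_inner_self_eq_norm_sq e)
  simp_rw [h3]
  simp [mul_comm]

/-- Weak maximum principle: the maximum of `z` over the closure is attained on the boundary. -/
theorem HasWeakLaplacian.exists_frontier_le {z h : E d → ℝ} {c : ℝ} (hΩ : IsOpen Ω) (hd : 0 < d)
    (hb : Bornology.IsBounded Ω) (hz : ContinuousOn z (closure Ω)) (H : HasWeakLaplacian Ω z h)
    (hc : 0 < c) (hh : ∀ᵐ x ∂(volume.restrict Ω), c ≤ h x) {x : E d} (hx : x ∈ closure Ω) :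
    ∃ y ∈ frontier Ω, z x ≤ z y := by
  obtain ⟨x₀, hx₀, hmax⟩ := hb.isCompact_closure.exists_isMaxOn ⟨x, hx⟩ hz
  by_cases hm : x₀ ∈ Ω
  swap
  · exact ⟨x₀, by rw [hΩ.frontier_eq]; exact ⟨hx₀, hm⟩, hmax hx⟩
  exfalso
  obtain ⟨ρ, hρ, hρb⟩ := Metric.nhds_basis_closedBall.mem_iff.1 (hΩ.mem_nhds hm)
  -- Subtracting `s‖y - x₀‖²` makes an interior maximum at `x₀` strict on spheres. Its Laplacian is
  -- `2ds = c/2`, so half of the lower bound `c` survives.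
  set s : ℝ := c / (4 * d)
  have hd' : (0 : ℝ) < d := Nat.cast_pos.2 hd
  have hs : 0 < s := by positivity
  have hq : ContDiff ℝ 2 fun y : E d => s * ‖y - x₀‖ ^ 2 :=
    contDiff_const.mul ((contDiff_id.sub contDiff_const).norm_sq ℝ)
  have H' := H.sub hΩ (hasWeakLaplacian_of_contDiffOn hΩ hq.contDiffOn)
  have hq' : ∀ x, (Laplacian.laplacian (fun y : E d => s * ‖y - x₀‖ ^ 2) : E d → ℝ) x = c / 2 := by
    intro x
    have h1 : ContDiffAt ℝ 2 (fun y : E d => ‖y - x₀‖ ^ 2) x :=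
      ((contDiff_id.sub contDiff_const).norm_sq ℝ).contDiffAt
    have h2 := InnerProductSpace.laplacian_smul s h1
    rw [laplacian_norm_sub_sq] at h2
    refine h2.trans ?_
    simp only [s, smul_eq_mul]
    field_simp
    ring
  refine H'.not_lt_on_sphere (x₀ := x₀) (r := ρ / 2) (c := c / 2) hd (by linarith) ?_
    (by linarith) (by simpa [mul_div_cancel₀] using hρb) ?_
  · filter_upwards [hh] with y hy
    rw [hq']
    linarith
  · intro y hy
    have hyΩ : y ∈ Ω := hρb (Metric.closedBall_subset_closedBall (by linarith)
      (Metric.sphere_subset_closedBall hy))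
    have h1 : z y ≤ z x₀ := hmax (subset_closure hyΩ)
    rw [mem_sphere_iff_norm] at hy
    have : 0 < s * ‖y - x₀‖ ^ 2 := by rw [hy]; positivity
    simp only [sub_self, norm_zero]
    linarith

/-- Adding `(K + δ)‖y‖²` raises the Laplacian to at least `-K + 2d(K + δ) ≥ δ > 0`, so the sum is
bounded by its boundary values, at most `K + (K + δ)R²`. Then `δ → 0`. -/
theorem HasWeakLaplacian.le_of_frontier {v h : E d → ℝ} {K R : ℝ} (hΩ : IsOpen Ω) (hd : 0 < d)
    (hR : Ω ⊆ Metric.closedBall 0 R) (hv : ContinuousOn v (closure Ω))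
    (H : HasWeakLaplacian Ω v h) (hK : 0 ≤ K) (hh : ∀ᵐ x ∂(volume.restrict Ω), -K ≤ h x)
    (hvb : ∀ x ∈ frontier Ω, v x ≤ K) {x : E d} (hx : x ∈ closure Ω) :
    v x ≤ K * (1 + R ^ 2) := by
  have hb : Bornology.IsBounded Ω := Metric.isBounded_closedBall.subset hR
  have hd' : (1 : ℝ) ≤ d := by exact_mod_cast hd
  have key : ∀ δ > 0, v x ≤ K + (K + δ) * R ^ 2 := by
    intro δ hδ
    have hq : ContDiff ℝ 2 fun y : E d => (K + δ) * ‖y - 0‖ ^ 2 :=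
      contDiff_const.mul ((contDiff_id.sub contDiff_const).norm_sq ℝ)
    have hq' : ∀ x, (Laplacian.laplacian (fun y : E d => (K + δ) * ‖y - 0‖ ^ 2) : E d → ℝ) x =
        (K + δ) * (2 * d) := by
      intro x
      have h1 : ContDiffAt ℝ 2 (fun y : E d => ‖y - 0‖ ^ 2) x :=
        ((contDiff_id.sub contDiff_const).norm_sq ℝ).contDiffAt
      have h2 := InnerProductSpace.laplacian_smul (K + δ) h1
      rw [laplacian_norm_sub_sq] at h2
      exact h2
    have H' := H.add hΩ (hasWeakLaplacian_of_contDiffOn hΩ hq.contDiffOn)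
    obtain ⟨y, hy, hle⟩ := H'.exists_frontier_le (c := δ) hΩ hd hb
      (hv.add hq.continuous.continuousOn) hδ (by
        filter_upwards [hh] with y hy
        rw [hq']
        nlinarith) hx
    simp only [Pi.add_apply] at hle
    have hyR : ‖y‖ ≤ R := by
      have := closure_minimal hR Metric.isClosed_closedBall (frontier_subset_closure hy)
      simpa using this
    have h1 : 0 ≤ (K + δ) * ‖x - 0‖ ^ 2 := by positivity
    have h2 : ‖y - 0‖ ^ 2 ≤ R ^ 2 := by
      rw [sub_zero]; exact pow_le_pow_left₀ (norm_nonneg y) hyR 2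
    have h3 : (K + δ) * ‖y - 0‖ ^ 2 ≤ (K + δ) * R ^ 2 :=
      mul_le_mul_of_nonneg_left h2 (by linarith)
    linarith [hvb y hy]
  refine le_of_forall_pos_le_add fun ε hε => ?_
  have h1 := key (ε / (R ^ 2 + 1)) (by positivity)
  have h2 : ε / (R ^ 2 + 1) * R ^ 2 ≤ ε := by
    rw [div_mul_eq_mul_div, div_le_iff₀ (by positivity)]
    nlinarith
  linarith

/-- A priori estimate for the Poisson problem in the supremum norm. -/
theorem HasWeakLaplacian.abs_le_of_frontier {v h : E d → ℝ} {K R : ℝ} (hΩ : IsOpen Ω) (hd : 0 < d)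
    (hR : Ω ⊆ Metric.closedBall 0 R) (hv : ContinuousOn v (closure Ω))
    (H : HasWeakLaplacian Ω v h) (hK : 0 ≤ K) (hh : ∀ᵐ x ∂(volume.restrict Ω), |h x| ≤ K)
    (hvb : ∀ x ∈ frontier Ω, |v x| ≤ K) {x : E d} (hx : x ∈ closure Ω) :
    |v x| ≤ K * (1 + R ^ 2) := by
  refine abs_le'.2 ⟨H.le_of_frontier hΩ hd hR hv hK ?_ (fun y hy => (abs_le.1 (hvb y hy)).2) hx,
    H.neg.le_of_frontier hΩ hd hR hv.neg hK ?_ (fun y hy => neg_le.1 (abs_le.1 (hvb y hy)).1) hx⟩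
  · filter_upwards [hh] with y hy using (abs_le.1 hy).1
  · filter_upwards [hh] with y hy using neg_le_neg (abs_le.1 hy).2

/-! ### Norms, the pseudo-inverse and smoothness of the approximation. -/

theorem le_supNorm (v : E d → ℝ) {x : E d} (hx : x ∈ closure Ω) : ‖v x‖ₑ ≤ supNorm Ω v :=
  le_iSup₂_of_le x hx le_rfl

theorem norm_mulVec_le_rowSumNorm {M N : ℕ} (A : Matrix (Fin M) (Fin N) ℝ) (v : Fin N → ℝ) :
    ‖A *ᵥ v‖ ≤ rowSumNorm A * ‖v‖ := by
  refine (pi_norm_le_iff_of_nonneg (by positivity)).2 fun i => ?_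
  have h1 : ∑ k, ‖A i k‖₊ ≤ rowSumNorm A :=
    Finset.le_sup (f := fun i => ∑ k, ‖A i k‖₊) (Finset.mem_univ i)
  have h2 : ∑ k, ‖A i k‖ ≤ rowSumNorm A := by
    have := NNReal.coe_le_coe.2 h1
    simpa using this
  calc ‖(A *ᵥ v) i‖ ≤ ∑ k, ‖A i k * v k‖ :=
        norm_sum_le Finset.univ fun k => A i k * v k
    _ ≤ ∑ k, ‖A i k‖ * ‖v‖ := Finset.sum_le_sum fun k _ => by
        rw [norm_mul]
        exact mul_le_mul_of_nonneg_left (norm_le_pi_norm v k) (norm_nonneg _)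
    _ ≤ rowSumNorm A * ‖v‖ := by
        rw [← Finset.sum_mul]
        exact mul_le_mul_of_nonneg_right h2 (norm_nonneg _)

namespace Scheme

variable {P N M : ℕ} (S : Scheme d P N M Ω)

theorem isUnit_det_transpose_mul_self (hL : S.L.rank = N) : IsUnit (S.Lᵀ * S.L).det := by
  have hr : (S.Lᵀ * S.L).rank = N := by rw [Matrix.rank_transpose_mul_self, hL]
  rw [← Matrix.isUnit_iff_isUnit_det, ← Matrix.mulVec_surjective_iff_isUnit]
  refine (LinearMap.range_eq_top (f := (S.Lᵀ * S.L).mulVecLin)).1 ?_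
  refine Submodule.eq_top_of_finrank_eq ?_
  rw [← Matrix.rank, hr, Module.finrank_fin_fun]

theorem Lplus_mul_L (hL : S.L.rank = N) : S.Lplus * S.L = 1 := by
  rw [Lplus, Matrix.mul_assoc, Matrix.nonsing_inv_mul _ (S.isUnit_det_transpose_mul_self hL)]

theorem contDiff_psi (j : Fin P) (k : S.J j) : ContDiff ℝ 2 fun x => S.psi j x k := by
  unfold psi Matrix.vecMul dotProduct
  refine ContDiff.sum fun i _ => ContDiff.mul ?_ contDiff_const
  exact S.contDiff_phi.comp (contDiff_id.sub contDiff_const)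

/-- The union of all patches is an open neighbourhood of `closure Ω`, so smoothness holds at
boundary points and across the edges of single patches. -/
theorem contDiffAt_w_mul_psi (j : Fin P) (k : S.J j) {x : E d} (hx : x ∈ closure Ω) :
    ContDiffAt ℝ 2 (fun y => S.w j y * S.psi j y k) x :=
  ((S.contDiffOn_w j).contDiffAt ((isOpen_iUnion S.isOpen_patch).mem_nhds (S.cover hx))).mul
    (S.contDiff_psi j k).contDiffAt

theorem approx_eq (V : Fin N → ℝ) :
    S.approx V = ∑ j, ∑ k : S.J j, V k • fun y => S.w j y * S.psi j y k := by
  funext x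
  simp only [approx, localApprox, Finset.sum_apply, Finset.mul_sum, Pi.smul_apply, smul_eq_mul]
  exact Finset.sum_congr rfl fun j _ => Finset.sum_congr rfl fun k _ => by ring

theorem contDiffAt_approx (V : Fin N → ℝ) {x : E d} (hx : x ∈ closure Ω) :
    ContDiffAt ℝ 2 (S.approx V) x := by
  rw [approx_eq]
  simp_rw [Finset.sum_fn]
  exact ContDiffAt.sum fun j _ => ContDiffAt.sum fun k _ =>
    contDiffAt_const.smul (S.contDiffAt_w_mul_psi j k hx)

end Scheme

/-! ### Linearity of `𝓛` and its matrix form. -/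

theorem laplacian_finset_sum {ι : Type*} (s : Finset ι) {v : ι → E d → ℝ} {x : E d}
    (hv : ∀ i ∈ s, ContDiffAt ℝ 2 (v i) x) :
    (Laplacian.laplacian (∑ i ∈ s, v i) : E d → ℝ) x =
      ∑ i ∈ s, (Laplacian.laplacian (v i) : E d → ℝ) x := by
  classical
  induction s using Finset.induction_on with
  | empty =>
    have : (0 : E d → ℝ) = fun _ => 0 := rfl
    simp [this]
  | insert a s ha ih =>
    rw [Finset.sum_insert ha, Finset.sum_insert ha, ContDiffAt.laplacian_add
      (hv a (Finset.mem_insert_self a s)), ih fun i hi => hv i (Finset.mem_insert_of_mem hi)]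
    have := ContDiffAt.sum (s := s) fun i hi => hv i (Finset.mem_insert_of_mem hi)
    simpa [Finset.sum_fn] using this

theorem calL_finset_sum {ι : Type*} (s : Finset ι) {v : ι → E d → ℝ} {x : E d}
    (hv : ∀ i ∈ s, ContDiffAt ℝ 2 (v i) x) :
    calL Ω (∑ i ∈ s, v i) x = ∑ i ∈ s, calL Ω (v i) x := by
  unfold calL
  split_ifs
  · rw [laplacian_finset_sum s hv, Finset.sum_neg_distrib]
  · simp

theorem calL_smul (c : ℝ) {v : E d → ℝ} {x : E d} (hv : ContDiffAt ℝ 2 v x) :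
    calL Ω (c • v) x = c * calL Ω v x := by
  unfold calL
  split_ifs
  · rw [InnerProductSpace.laplacian_smul c hv, smul_eq_mul, mul_neg]
  · simp

namespace Scheme

variable {P N M : ℕ} (S : Scheme d P N M Ω)

theorem calL_approx (V : Fin N → ℝ) {x : E d} (hx : x ∈ closure Ω) :
    calL Ω (S.approx V) x = S.Lrow x ⬝ᵥ V := by
  have h := fun j k => S.contDiffAt_w_mul_psi j k hx
  rw [approx_eq, calL_finset_sum]
  swap
  · exact fun j _ => by
      simpa [Finset.sum_fn] using ContDiffAt.sum (s := Finset.univ)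
        fun (k : S.J j) _ => (contDiffAt_const (c := V (k : Fin N))).smul (h j k)
  have h1 : ∀ j, calL Ω (∑ k : S.J j, V k • fun y => S.w j y * S.psi j y k) x =
      ∑ k, (if h : k ∈ S.J j then calL Ω (fun y => S.w j y * S.psi j y ⟨k, h⟩) x else 0) * V k := by
    intro j
    rw [calL_finset_sum (v := fun k : S.J j => V k • fun y => S.w j y * S.psi j y k) _ fun k _ =>
      (contDiffAt_const (c := V (k : Fin N))).smul (h j k)]
    -- The global row is padded with zeros at nodes not belonging to patch `j`.
    rw [← Finset.sum_subset (Finset.subset_univ (S.J j)) fun k _ hk => by simp [hk],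
      ← Finset.sum_coe_sort (S.J j)]
    refine Finset.sum_congr rfl fun k _ => ?_
    rw [calL_smul _ (h j k)]
    simp [mul_comm]
  simp_rw [h1, dotProduct, Lrow, Finset.sum_mul]
  exact Finset.sum_comm

theorem L_mulVec (V : Fin N → ℝ) (i : Fin M) :
    (S.L *ᵥ V) i = calL Ω (S.approx V) (S.Y i) := (S.calL_approx V (S.Y_mem i)).symm

/-! ### The error under `𝓛`. -/

/-- The error of the computed solution under `𝓛`, in terms of the interpolation error and a
perturbation `e` of the residual that is not seen by `L⁺`. -/
theorem calL_approx_sub_data {f g u : E d → ℝ} (hL : S.L.rank = N) {U : Fin N → ℝ}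
    {e : Fin M → ℝ} (he : S.Lᵀ *ᵥ (S.residual f g U - e) = 0) {x : E d} (hx : x ∈ closure Ω) :
    calL Ω (S.approx U) x - data Ω f g x = S.interpError f g u x +
      (S.Lrow x ᵥ* S.Lplus) ⬝ᵥ (e - fun i => S.interpError f g u (S.Y i)) := by
  set V : Fin N → ℝ := fun k => u (S.X k)
  -- Residual and interpolation error contain the same data `F(Y)`, which cancels.
  have h1 : S.residual f g U - (fun i => S.interpError f g u (S.Y i)) = S.L *ᵥ (U - V) := by
    funext i
    rw [Matrix.mulVec_sub]
    simp only [Pi.sub_apply, residual, interpError, S.L_mulVec V, interp, V]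
    ring
  have h2 : S.Lplus *ᵥ S.residual f g U = S.Lplus *ᵥ e := by
    rw [← sub_eq_zero, ← Matrix.mulVec_sub, Lplus, ← Matrix.mulVec_mulVec, he,
      Matrix.mulVec_zero]
  have h3 : S.Lplus *ᵥ (e - fun i => S.interpError f g u (S.Y i)) = U - V := by
    rw [Matrix.mulVec_sub, ← h2, ← Matrix.mulVec_sub, h1, Matrix.mulVec_mulVec,
      S.Lplus_mul_L hL, Matrix.one_mulVec]
  rw [← Matrix.dotProduct_mulVec, h3, dotProduct_sub, interpError, interp,
    S.calL_approx U hx, S.calL_approx V hx]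
  ring

/-- Duality of the `ℓ¹` and `ℓ^∞` norms: the row `L(x,X)L⁺` acts on `e - 𝓔(Y)`, whose entries are at
most `τ + ‖𝓔‖_∞` because the evaluation points lie in `closure Ω`. -/
theorem supNorm_calL_approx_sub_data_le {f g u : E d → ℝ} (hL : S.L.rank = N) {U : Fin N → ℝ}
    {τ : ℝ} (hU : OrthogonalUpTo S.L (S.residual f g U) τ) :
    supNorm Ω (fun x => calL Ω (S.approx U) x - data Ω f g x) ≤
      supNorm Ω (S.interpError f g u) +
        S.stabilityNorm * (ENNReal.ofReal τ + supNorm Ω (S.interpError f g u)) := by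
  obtain ⟨e, heτ, he⟩ := hU
  refine iSup₂_le fun x hx => ?_
  beta_reduce
  rw [S.calL_approx_sub_data (u := u) hL he hx]
  refine (enorm_add_le _ _).trans (add_le_add (le_supNorm _ hx) ?_)
  have h1 : ∀ i, ‖(e - fun i => S.interpError f g u (S.Y i)) i‖ₑ ≤
      ENNReal.ofReal τ + supNorm Ω (S.interpError f g u) := fun i => by
    refine (enorm_sub_le).trans (add_le_add ?_ (le_supNorm _ (S.Y_mem i)))
    rw [← ofReal_norm]
    exact ENNReal.ofReal_le_ofReal ((norm_le_pi_norm e i).trans heτ)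
  refine (enorm_sum_le _ _).trans ?_
  calc ∑ i, ‖(S.Lrow x ᵥ* S.Lplus) i * (e - fun i => S.interpError f g u (S.Y i)) i‖ₑ
      ≤ ∑ i, ‖(S.Lrow x ᵥ* S.Lplus) i‖ₑ *
          (ENNReal.ofReal τ + supNorm Ω (S.interpError f g u)) :=
        Finset.sum_le_sum fun i _ => by
          rw [enorm_mul]
          exact mul_le_mul_right (h1 i) _
    _ ≤ _ := by
        rw [← Finset.sum_mul]
        refine mul_le_mul_left ?_ _
        exact le_iSup₂_of_le (f := fun x _ => ∑ i, ‖(S.Lrow x ᵥ* S.Lplus) i‖ₑ) x hx le_rfl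

/-! ### From the error under `𝓛` to the error of the solution. -/

theorem enorm_approx_sub_le {f g u : E d → ℝ} {R : ℝ} (hΩ : IsOpen Ω) (hd : 0 < d)
    (hR : Ω ⊆ Metric.closedBall 0 R) (hu : SolvesPoisson Ω f g u) (U : Fin N → ℝ) {x : E d}
    (hx : x ∈ closure Ω) :
    ‖S.approx U x - u x‖ₑ ≤ ENNReal.ofReal (1 + R ^ 2) *
      supNorm Ω (fun x => calL Ω (S.approx U) x - data Ω f g x) := by
  set T := supNorm Ω (fun x => calL Ω (S.approx U) x - data Ω f g x)
  have hC : (0 : ℝ) < 1 + R ^ 2 := by positivity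
  -- An infinite supremum gives a trivial bound, since the factor `1 + R²` is nonzero.
  by_cases hT : T = ⊤
  · rw [hT, ENNReal.mul_top (by simpa using hC)]
    exact le_top
  obtain ⟨D, hD, hpde⟩ := hu.pde
  have hK : ∀ y ∈ closure Ω, |calL Ω (S.approx U) y - data Ω f g y| ≤ T.toReal := fun y hy => by
    have := ENNReal.toReal_mono hT
      (le_supNorm (fun x => calL Ω (S.approx U) x - data Ω f g x) hy)
    simpa using this
  have hW := (hasWeakLaplacian_of_contDiffOn hΩ fun y hy =>
    (S.contDiffAt_approx U (subset_closure hy)).contDiffWithinAt).sub hΩ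
    (hasWeakLaplacian_of_isWeakDeriv hΩ (hu.continuousOn.mono subset_closure) hD)
  have := hW.abs_le_of_frontier (K := T.toReal) hΩ hd hR
    (ContinuousOn.sub (fun y hy => (S.contDiffAt_approx U hy).continuousAt.continuousWithinAt)
      hu.continuousOn) ENNReal.toReal_nonneg ?_ ?_ hx
  · rw [← ofReal_norm, Real.norm_eq_abs]
    refine (ENNReal.ofReal_le_ofReal this).trans ?_
    rw [mul_comm, ENNReal.ofReal_mul hC.le, ENNReal.ofReal_toReal hT]
  · filter_upwards [hpde, ae_restrict_mem hΩ.measurableSet] with y hy hyΩ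
    have h1 := hK y (subset_closure hyΩ)
    simp only [calL, data, hyΩ, if_true, ← hy] at h1
    rw [← abs_neg]
    convert h1 using 2
    ring
  · intro y hy
    have hyΩ : y ∉ Ω := by
      rw [hΩ.frontier_eq] at hy
      exact hy.2
    have h1 := hK y (frontier_subset_closure hy)
    simpa [calL, data, hyΩ, ← hu.boundary y hy] using h1

theorem eLpNorm_approx_sub_le {f g u : E d → ℝ} {R : ℝ} (hΩ : IsOpen Ω) (hd : 0 < d)
    (hR : Ω ⊆ Metric.closedBall 0 R) (hu : SolvesPoisson Ω f g u) (U : Fin N → ℝ) :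
    eLpNorm (fun x => S.approx U x - u x) 2 (volume.restrict Ω) ≤
      volume Ω ^ (1 / 2 : ℝ) * ENNReal.ofReal (1 + R ^ 2) *
        supNorm Ω (fun x => calL Ω (S.approx U) x - data Ω f g x) := by
  set B := ENNReal.ofReal (1 + R ^ 2) *
    supNorm Ω (fun x => calL Ω (S.approx U) x - data Ω f g x)
  have h1 : eLpNorm (fun x => S.approx U x - u x) 2 (volume.restrict Ω) ≤
      eLpNorm (fun _ : E d => B) 2 (volume.restrict Ω) := by
    refine eLpNorm_mono_enorm_ae ?_
    filter_upwards [ae_restrict_mem hΩ.measurableSet] with y hy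
    simpa using S.enorm_approx_sub_le hΩ hd hR hu U (subset_closure hy)
  refine h1.trans ?_
  rw [eLpNorm_const' _ (by norm_num) (by norm_num)]
  simp [B, mul_comm, mul_left_comm, mul_assoc]

/-- Collocation case: the whole residual is taken as the perturbation, `e = r`. -/
theorem orthogonalUpTo_of_norm_le {f g : E d → ℝ} {U : Fin N → ℝ} {τ : ℝ}
    (h : ‖S.residual f g U‖ ≤ τ) : OrthogonalUpTo S.L (S.residual f g U) τ :=
  ⟨_, h, by simp⟩

/-- Here `e = L(LᵀL)⁻¹Lᵀr` is the orthogonal projection of `r` onto the column space of `L`, so `Lᵀe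
= Lᵀr`. -/
theorem orthogonalUpTo_of_norm_mulVec_le {f g : E d → ℝ} {U : Fin N → ℝ} {τ : ℝ}
    (hL : S.L.rank = N) (h : ‖S.Lᵀ *ᵥ S.residual f g U‖ ≤ τ) :
    OrthogonalUpTo S.L (S.residual f g U) (rowSumNorm (S.L * (S.Lᵀ * S.L)⁻¹) * τ) := by
  refine ⟨(S.L * (S.Lᵀ * S.L)⁻¹) *ᵥ (S.Lᵀ *ᵥ S.residual f g U),
    (norm_mulVec_le_rowSumNorm _ _).trans (mul_le_mul_of_nonneg_left h (by positivity)), ?_⟩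
  rw [Matrix.mulVec_sub, Matrix.mulVec_mulVec _ S.Lᵀ (S.L * _), ← Matrix.mul_assoc,
    Matrix.mul_nonsing_inv _ (S.isUnit_det_transpose_mul_self hL), Matrix.one_mulVec, sub_self]

end Scheme

end RBFPUM

end
-- The error estimate.
theorem mainTheorem1 (d : ℕ) (hd : 0 < d) (Ω : Set (RBFPUM.E d)) (hΩ : IsOpen Ω)
    (hΩb : Bornology.IsBounded Ω) :
    ∃ CP : ℝ≥0, ∀ (m : ℕ) (f g u : RBFPUM.E d → ℝ), 2 ≤ m →
      RBFPUM.MemSobolev m ∞ Ω u → RBFPUM.SolvesPoisson Ω f g u →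
      ∀ (P N M : ℕ) (S : RBFPUM.Scheme d P N M Ω), S.L.rank = N →
      ∀ (U : Fin N → ℝ) (CM δM : ℝ),
        -- collocation: the residual is of the size of the rounding error
        (S.IsCollocation → ‖S.residual f g U‖ ≤ CM * δM →
          eLpNorm (fun x => S.approx U x - u x) 2 (volume.restrict Ω) ≤
            S.errorBound CP f g u (CM * δM)) ∧
        -- least squares: the residual is orthogonal to the columns up to the rounding error
        (S.IsLeastSquares → RBFPUM.OrthogonalUpTo S.L (S.residual f g U) (CM * δM) →
          eLpNorm (fun x => S.approx U x - u x) 2 (volume.restrict Ω) ≤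
            S.errorBound CP f g u (CM * δM)) ∧
        -- least squares, with the rounding error measured in the product `Lᵀ r`
        (S.IsLeastSquares → ‖S.Lᵀ *ᵥ S.residual f g U‖ ≤ CM * δM →
          eLpNorm (fun x => S.approx U x - u x) 2 (volume.restrict Ω) ≤
            S.errorBound CP f g u
              (RBFPUM.rowSumNorm (S.L * (S.Lᵀ * S.L)⁻¹) * CM * δM)) := by
  obtain ⟨R, hR⟩ := hΩb.subset_closedBall 0
  set κ : ℝ≥0∞ := volume Ω ^ (1 / 2 : ℝ) * ENNReal.ofReal (1 + R ^ 2)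
  have hκ : κ ≠ ⊤ := ENNReal.mul_ne_top
    (ENNReal.rpow_ne_top_of_nonneg (by norm_num) hΩb.measure_lt_top.ne) ENNReal.ofReal_ne_top
  refine ⟨κ.toNNReal, fun m f g u _ _ hu P N M S hL U CM δM => ?_⟩
  -- All three cases are instances of orthogonality up to a perturbation of size `τ`.
  have key : ∀ τ : ℝ, RBFPUM.OrthogonalUpTo S.L (S.residual f g U) τ →
      eLpNorm (fun x => S.approx U x - u x) 2 (volume.restrict Ω) ≤
        S.errorBound κ.toNNReal f g u τ := fun τ hτ => by
    refine (S.eLpNorm_approx_sub_le hΩ hd hR hu U).trans ?_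
    rw [RBFPUM.Scheme.errorBound, ENNReal.coe_toNNReal hκ, mul_assoc κ S.stabilityNorm, ← mul_add]
    exact mul_le_mul_right (S.supNorm_calL_approx_sub_data_le hL hτ) κ
  refine ⟨fun _ h => key _ (S.orthogonalUpTo_of_norm_le h), fun _ h => key _ h, fun _ h => ?_⟩
  rw [mul_assoc]
  exact key _ (S.orthogonalUpTo_of_norm_mulVec_le hL h)
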